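/- Let $n\ge 1$, let $(a_{i,j})_{1\le i,j\le n}$ be an array of non-negative real numbers, not all equal to zero, and let $\Pi_n$ be a uniformly distributed random permutation of $\{1,\dots,n\}$. Put $Z_n=\sum_{i=1}^n a_{i,\Pi_n(i)}$. Then, for all $x>0$, $$\mathbb P\left(\,|Z_n-\mathbb E[Z_n]|\ \ge\ 2\sqrt{\Big(\frac1n\sum_{i,j=1}^n a_{i,j}^2\Big)x}\;+\;\Big(\max_{1\le i,j\le n}a_{i,j}\Big)x\right)\ \le\ 8\,e^{1/16}\,e^{-x/16}.$$ -/

import Mathlib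

open MeasureTheory ProbabilityTheory

/-- The symmetric group on `{1, …, n}` (modelled on `Fin n`) carries the discrete σ-algebra. -/
instance instMeasurableSpacePermFin (n : ℕ) : MeasurableSpace (Equiv.Perm (Fin n)) := ⊤

instance instDiscreteMeasurableSpacePermFin (n : ℕ) :
    DiscreteMeasurableSpace (Equiv.Perm (Fin n)) :=
  ⟨fun _ => MeasurableSpace.measurableSet_top⟩

/-- `π` is a uniform random permutation of `{1, …, n}` on the probability space `(Ω, P)`:
it is a random variable whose law is the uniform distribution on the symmetric group. -/
def IsUniformPermutation {Ω : Type*} [MeasurableSpace Ω] (P : Measure Ω) {n : ℕ}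
    (π : Ω → Equiv.Perm (Fin n)) : Prop :=
  HasLaw π (uniformOn (Set.univ : Set (Equiv.Perm (Fin n)))) P

/-- The permuted sum `∑ i, a i (σ i)` of an array `a` along a permutation `σ`. -/
def permutedSum {n : ℕ} (a : Fin n → Fin n → ℝ) (σ : Equiv.Perm (Fin n)) : ℝ :=
  ∑ i, a i (σ i)

/-! An exponential moment of the permuted sum is a normalised permanent of a positive matrix. The
Carlen–Lieb–Loss inequality `sq_sum_perm_prod_le` bounds its square by a product of row averages, as
if rows were sampled independently with doubled exponents. For small parameters, `exp u ≤ 1 + u + u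
^ 2` gives a centred moment generating function at most `exp (2 * l ^ 2 * v)`, with `v` the
normalised sum of squares. Chernoff's bound on each tail then yields `2 * exp (-x / 2)`, stronger
than required. -/

/-! ### Scalar inequalities for the induction on permanents -/

open Finset in
/-- Bernoulli's inequality for finitely many non-negative increments. -/
lemma one_add_sum_le_prod_one_add_of_nonneg {ι : Type*} (s : Finset ι) (u : ι → ℝ)
    (hu : ∀ i ∈ s, 0 ≤ u i) : 1 + ∑ i ∈ s, u i ≤ ∏ i ∈ s, (1 + u i) := by
  classical
  induction s using Finset.induction_on with
  | empty => simp
  | insert i s hi ih =>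
    rw [sum_insert hi, prod_insert hi]
    have h0 := hu i (mem_insert_self i s)
    have h1 := sum_nonneg fun j hj => hu j (mem_insert_of_mem hj)
    have h2 := ih fun j hj => hu j (mem_insert_of_mem hj)
    nlinarith [mul_nonneg h0 h1]

open Finset in
/-- Bernoulli's inequality for finitely many increments in `[-1, 0]`. -/
lemma one_add_sum_le_prod_one_add_of_nonpos {ι : Type*} (s : Finset ι) (u : ι → ℝ)
    (hu : ∀ i ∈ s, u i ≤ 0) (hu' : ∀ i ∈ s, -1 ≤ u i) :
    1 + ∑ i ∈ s, u i ≤ ∏ i ∈ s, (1 + u i) := by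
  classical
  induction s using Finset.induction_on with
  | empty => simp
  | insert i s hi ih =>
    rw [sum_insert hi, prod_insert hi]
    have h0 := hu i (mem_insert_self i s)
    have h0' := hu' i (mem_insert_self i s)
    have h1 := sum_nonpos fun j hj => hu j (mem_insert_of_mem hj)
    have h2 := ih (fun j hj => hu j (mem_insert_of_mem hj))
      fun j hj => hu' j (mem_insert_of_mem hj)
    nlinarith [mul_nonneg_of_nonpos_of_nonpos h0 h1]

-- Each factor is `m * (1 + u i)` with `u i ≥ -1`. Bernoulli needs increments of one sign, so
-- indices are split by the sign of `u i`, and Cauchy–Schwarz recombines the two halves.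
open Finset in
lemma sq_sum_mul_card_pow_le_prod_sq_add {ι : Type*} [Fintype ι] [Nonempty ι] (x : ι → ℝ) :
    (∑ i, x i) ^ 2 * (Fintype.card ι : ℝ) ^ Fintype.card ι ≤
      (Fintype.card ι : ℝ) ^ 2 * ∏ i, (x i ^ 2 + ((Fintype.card ι : ℝ) - 1)) := by
  classical
  set m : ℝ := (Fintype.card ι : ℝ) with hm
  have hm1 : 1 ≤ m := by
    rw [hm]; exact_mod_cast Fintype.card_pos
  have hm0 : 0 < m := by linarith
  set u : ι → ℝ := fun i => (x i ^ 2 - 1) / m with hu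
  have hmu : ∀ i, m * u i = x i ^ 2 - 1 := fun i => by simp only [hu]; field_simp
  have hprod : ∏ i, (x i ^ 2 + (m - 1)) = m ^ Fintype.card ι * ∏ i, (1 + u i) := by
    rw [← card_univ, ← prod_const, ← prod_mul_distrib]
    exact prod_congr rfl fun i _ => by linear_combination -hmu i
  set S : Finset ι := univ.filter fun i => 1 ≤ x i ^ 2 with hS
  set T : Finset ι := univ.filter fun i => ¬ 1 ≤ x i ^ 2 with hT
  have hSe : 1 + ∑ i ∈ S, u i ≤ ∏ i ∈ S, (1 + u i) := by
    refine one_add_sum_le_prod_one_add_of_nonneg S u fun i hi => ?_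
    have : 1 ≤ x i ^ 2 := (mem_filter.1 hi).2
    exact div_nonneg (by linarith) hm0.le
  have hu1 : ∀ i, -1 ≤ u i := fun i => by
    have := hmu i
    have := sq_nonneg (x i)
    nlinarith
  have hTe : 1 + ∑ i ∈ T, u i ≤ ∏ i ∈ T, (1 + u i) := by
    refine one_add_sum_le_prod_one_add_of_nonpos T u (fun i hi => ?_) fun i _ => hu1 i
    have : ¬ 1 ≤ x i ^ 2 := (mem_filter.1 hi).2
    exact div_nonpos_of_nonpos_of_nonneg (by linarith) hm0.le
  have hcard : (#S : ℝ) + #T = m := by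
    rw [hm, ← card_univ, ← card_filter_add_card_filter_not (s := univ) fun i => 1 ≤ x i ^ 2]
    push_cast; rfl
  have hS1 : m * (1 + ∑ i ∈ S, u i) = #T + ∑ i ∈ S, x i ^ 2 := by
    rw [mul_add, mul_sum, sum_congr rfl fun i _ => hmu i, sum_sub_distrib]
    simp only [sum_const, nsmul_eq_mul, mul_one]
    linarith
  have hT1 : m * (1 + ∑ i ∈ T, u i) = #S + ∑ i ∈ T, x i ^ 2 := by
    rw [mul_add, mul_sum, sum_congr rfl fun i _ => hmu i, sum_sub_distrib]
    simp only [sum_const, nsmul_eq_mul, mul_one]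
    linarith
  have hCS : (∑ i, x i) ^ 2 ≤ (#T + ∑ i ∈ S, x i ^ 2) * (#S + ∑ i ∈ T, x i ^ 2) := by
    -- Each `x i` is factored as `x i * 1` or `1 * x i`, so that the two sums of squares are exactly
    -- the two Bernoulli sides.
    have h := sum_mul_sq_le_sq_mul_sq univ (fun i => if 1 ≤ x i ^ 2 then x i else 1)
      (fun i => if 1 ≤ x i ^ 2 then 1 else x i)
    have e1 : ∀ i, (if 1 ≤ x i ^ 2 then x i else 1) * (if 1 ≤ x i ^ 2 then 1 else x i) = x i :=
      fun i => by split_ifs <;> ring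
    simp only [e1, ite_pow, one_pow, sum_ite, sum_const, nsmul_eq_mul, mul_one] at h
    linarith
  have hT0 : 0 ≤ m * (1 + ∑ i ∈ T, u i) := by
    rw [hT1]; exact add_nonneg (Nat.cast_nonneg _) (sum_nonneg fun i _ => sq_nonneg _)
  have hP0 : 0 ≤ ∏ i ∈ S, (1 + u i) := prod_nonneg fun i _ => by linarith [hu1 i]
  have key : (∑ i, x i) ^ 2 ≤ m ^ 2 * ∏ i, (1 + u i) := by
    rw [← prod_filter_mul_prod_filter_not univ fun i => 1 ≤ x i ^ 2]
    calc (∑ i, x i) ^ 2 ≤ (m * (1 + ∑ i ∈ S, u i)) * (m * (1 + ∑ i ∈ T, u i)) := by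
          rw [hS1, hT1]; exact hCS
      _ ≤ (m * ∏ i ∈ S, (1 + u i)) * (m * ∏ i ∈ T, (1 + u i)) := by gcongr
      _ = _ := by ring
  rw [hprod]
  calc _ ≤ (m ^ 2 * ∏ i, (1 + u i)) * m ^ Fintype.card ι := by gcongr
    _ = _ := by ring

-- Homogeneous form of the preceding inequality, at `x i = √n * (y i / w i)`. It closes the
-- induction, the sum being a column expansion with minors replaced by their bounds.
open Finset in
lemma sq_sum_mul_prod_erase_le {ι : Type*} [Fintype ι] [DecidableEq ι] {n : ℕ}
    (hn : Fintype.card ι = n + 1) (y w : ι → ℝ) (hw : ∀ i, 0 < w i) :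
    (∑ p, y p * ∏ k ∈ univ.erase p, w k) ^ 2 * ((n + 1 : ℕ) : ℝ) ^ (n + 1) ≤
      ((n + 1 : ℕ) : ℝ) ^ 2 * (n : ℝ) ^ n * ∏ i, (y i ^ 2 + w i ^ 2) := by
  have : Nonempty ι := Fintype.card_pos_iff.1 (by omega)
  have hW : 0 < ∏ k, w k := prod_pos fun k _ => hw k
  have hsum : ∑ p, y p * ∏ k ∈ univ.erase p, w k = (∏ k, w k) * ∑ p, y p / w p := by
    rw [mul_sum]
    refine sum_congr rfl fun p _ => ?_
    rw [← mul_prod_erase univ w (mem_univ p)]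
    have := (hw p).ne'
    field_simp
  rcases n.eq_zero_or_pos with rfl | hn0
  · obtain ⟨i, hi⟩ := Fintype.card_eq_one_iff.1 hn
    have hu : (univ : Finset ι) = {i} := by ext j; simp [hi j]
    simp [hu]; positivity
  have hnR : (0 : ℝ) < n := by exact_mod_cast hn0
  have h := sq_sum_mul_card_pow_le_prod_sq_add fun i => √n * (y i / w i)
  have e : ∀ i, (√(n : ℝ) * (y i / w i)) ^ 2 + (((n + 1 : ℕ) : ℝ) - 1) =
      n * (y i ^ 2 + w i ^ 2) / w i ^ 2 := fun i => by
    have := (hw i).ne'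
    rw [mul_pow, Real.sq_sqrt hnR.le]; push_cast; field_simp; ring
  rw [hn] at h
  simp only [e] at h
  rw [← mul_sum, mul_pow, Real.sq_sqrt hnR.le, prod_div_distrib, prod_mul_distrib, prod_const,
    card_univ, hn, prod_pow, ← mul_div_assoc, le_div_iff₀ (by positivity)] at h
  rw [hsum]
  refine le_of_mul_le_mul_left ?_ hnR
  calc _ = _ := ?_
    _ ≤ _ := h
    _ = _ := ?_
  · ring
  · ring

/-! ### Permanents -/

-- Laplace expansion along column `0`: the rows `Equiv.swap 0 p k.succ` are all those other than
-- `p`.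
open Finset in
lemma sum_perm_prod_succ {R : Type*} [CommSemiring R] {n : ℕ}
    (f : Fin (n + 1) → Fin (n + 1) → R) :
    ∑ σ : Equiv.Perm (Fin (n + 1)), ∏ i, f (σ i) i =
      ∑ p, f p 0 * ∑ τ : Equiv.Perm (Fin n),
        ∏ k, f (Equiv.swap 0 p (τ k).succ) k.succ := by
  rw [← Equiv.sum_comp Equiv.Perm.decomposeFin.symm, Fintype.sum_prod_type]
  refine sum_congr rfl fun p _ => ?_
  rw [mul_sum]
  refine sum_congr rfl fun τ _ => ?_
  rw [Fin.prod_univ_succ]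
  simp

open Finset in
/-- The Hadamard-type inequality of Carlen, Lieb and Loss for permanents of positive matrices. -/
theorem sq_sum_perm_prod_le {n : ℕ} (f : Fin n → Fin n → ℝ) (hf : ∀ i j, 0 < f i j) :
    (∑ σ : Equiv.Perm (Fin n), ∏ i, f (σ i) i) ^ 2 * (n : ℝ) ^ n ≤
      (n.factorial : ℝ) ^ 2 * ∏ i, ∑ j, f i j ^ 2 := by
  induction n with
  | zero => simp
  | succ n ih =>
    -- For a single column the truncated row norms `w` below would vanish.
    rcases n.eq_zero_or_pos with rfl | hn0
    · simp
    have : Nonempty (Fin n) := ⟨⟨0, hn0⟩⟩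
    have hnn : (0 : ℝ) < (n : ℝ) ^ n := by positivity
    set w : Fin (n + 1) → ℝ := fun k => √(∑ j : Fin n, f k j.succ ^ 2) with hw
    have hsum0 : ∀ k, 0 < ∑ j : Fin n, f k j.succ ^ 2 := fun k =>
      sum_pos (fun j _ => pow_pos (hf _ _) 2) univ_nonempty
    have hw0 : ∀ k, 0 < w k := fun k => Real.sqrt_pos.2 (hsum0 k)
    have hw2 : ∀ k, w k ^ 2 = ∑ j : Fin n, f k j.succ ^ 2 := fun k => Real.sq_sqrt (hsum0 k).le
    have hminor : ∀ p, (∑ τ : Equiv.Perm (Fin n),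
        ∏ k, f (Equiv.swap 0 p (τ k).succ) k.succ) * √((n : ℝ) ^ n) ≤
        n.factorial * ∏ k ∈ univ.erase p, w k := fun p => by
      have h := ih (fun k j => f (Equiv.swap 0 p k.succ) j.succ) fun _ _ => hf _ _
      have e : ∏ k : Fin n, w (Equiv.swap 0 p k.succ) = ∏ k ∈ univ.erase p, w k := by
        have h1 := Equiv.prod_comp (Equiv.swap 0 p) w
        rw [Fin.prod_univ_succ, Equiv.swap_apply_left,
          ← mul_prod_erase univ w (mem_univ p)] at h1
        exact mul_left_cancel₀ (hw0 p).ne' h1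
      simp only [← hw2] at h
      rw [prod_pow, e, ← Real.sq_sqrt hnn.le, ← mul_pow, ← mul_pow] at h
      exact le_of_sq_le_sq h (by have := prod_nonneg fun k (_ : k ∈ univ.erase p) => (hw0 k).le
                                 positivity)
    have hper : (∑ σ : Equiv.Perm (Fin (n + 1)), ∏ i, f (σ i) i) * √((n : ℝ) ^ n) ≤
        n.factorial * ∑ p, f p 0 * ∏ k ∈ univ.erase p, w k := by
      rw [sum_perm_prod_succ, sum_mul, mul_sum]
      refine sum_le_sum fun p _ => ?_
      nlinarith [mul_le_mul_of_nonneg_left (hminor p) (hf p 0).le]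
    have hper0 : 0 ≤ ∑ σ : Equiv.Perm (Fin (n + 1)), ∏ i, f (σ i) i :=
      sum_nonneg fun σ _ => prod_nonneg fun i _ => (hf _ _).le
    have hsq := pow_le_pow_left₀ (by positivity) hper 2
    rw [mul_pow, mul_pow, Real.sq_sqrt hnn.le] at hsq
    have hB := sq_sum_mul_prod_erase_le (Fintype.card_fin (n + 1)) (fun p => f p 0) w hw0
    have hN : ∀ i, ∑ j, f i j ^ 2 = f i 0 ^ 2 + w i ^ 2 := fun i => by
      rw [hw2, Fin.sum_univ_succ]
    simp only [hN]
    refine le_of_mul_le_mul_right ?_ hnn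
    calc _ = ((∑ σ : Equiv.Perm (Fin (n + 1)), ∏ i, f (σ i) i) ^ 2 * (n : ℝ) ^ n) *
          ((n + 1 : ℕ) : ℝ) ^ (n + 1) := by ring
      _ ≤ ((n.factorial : ℝ) ^ 2 * (∑ p, f p 0 * ∏ k ∈ univ.erase p, w k) ^ 2) *
          ((n + 1 : ℕ) : ℝ) ^ (n + 1) := by gcongr
      _ = (n.factorial : ℝ) ^ 2 * ((∑ p, f p 0 * ∏ k ∈ univ.erase p, w k) ^ 2 *
          ((n + 1 : ℕ) : ℝ) ^ (n + 1)) := by ring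
      _ ≤ (n.factorial : ℝ) ^ 2 * (((n + 1 : ℕ) : ℝ) ^ 2 * (n : ℝ) ^ n *
          ∏ i, (f i 0 ^ 2 + w i ^ 2)) := by gcongr
      _ = _ := by rw [Nat.factorial_succ]; push_cast; ring

/-! ### Mean and exponential moments under a uniform permutation -/

-- The sum over `σ` does not depend on `i`, by right translation with a transposition; summing over
-- all positions gives the value.
open Finset in
lemma card_mul_sum_perm_apply {n : ℕ} (g : Fin n → ℝ) (i : Fin n) :
    n * ∑ σ : Equiv.Perm (Fin n), g (σ i) = n.factorial * ∑ j, g j := by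
  have h : ∀ k, ∑ σ : Equiv.Perm (Fin n), g (σ k) = ∑ σ : Equiv.Perm (Fin n), g (σ i) :=
    fun k => by
      rw [← Equiv.sum_comp (Equiv.mulRight (Equiv.swap i k))]
      simp
  have h2 : ∑ k, ∑ σ : Equiv.Perm (Fin n), g (σ k) = n.factorial * ∑ j, g j := by
    rw [sum_comm, sum_congr rfl fun σ _ => Equiv.sum_comp σ g]
    simp [Fintype.card_perm]
  rw [← h2, sum_congr rfl fun k _ => h k]
  simp

lemma IsUniformPermutation.integral_comp {Ω : Type*} [MeasurableSpace Ω] {P : Measure Ω} {n : ℕ}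
    {π : Ω → Equiv.Perm (Fin n)} (hπ : IsUniformPermutation P π)
    (F : Equiv.Perm (Fin n) → ℝ) :
    ∫ ω, F (π ω) ∂P = (∑ σ, F σ) / n.factorial := by
  have h := HasLaw.integral_comp hπ (f := F) (by fun_prop)
  rw [show ∫ ω, F (π ω) ∂P = P[F ∘ π] from rfl, h, uniformOn, ProbabilityTheory.cond, Measure.restrict_univ,
    integral_smul_measure, integral_count]
  simp [Measure.count_apply_finite _ Set.finite_univ, Fintype.card_perm, div_eq_inv_mul]

lemma IsUniformPermutation.integrable_comp {Ω : Type*} [MeasurableSpace Ω] {P : Measure Ω}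
    [IsFiniteMeasure P] {n : ℕ} {π : Ω → Equiv.Perm (Fin n)} (hπ : IsUniformPermutation P π)
    (F : Equiv.Perm (Fin n) → ℝ) : Integrable (fun ω => F (π ω)) P := by
  have := Measure.isFiniteMeasure_map P π
  exact (Integrable.of_finite (μ := P.map π) (f := F)).comp_aemeasurable hπ.aemeasurable

open Finset in
lemma IsUniformPermutation.integral_permutedSum {Ω : Type*} [MeasurableSpace Ω] {P : Measure Ω}
    {n : ℕ} (hn : 0 < n) {π : Ω → Equiv.Perm (Fin n)} (hπ : IsUniformPermutation P π)
    (a : Fin n → Fin n → ℝ) :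
    ∫ ω, permutedSum a (π ω) ∂P = ∑ i, (∑ j, a i j) / n := by
  have hn' : (n : ℝ) ≠ 0 := by positivity
  rw [hπ.integral_comp (permutedSum a)]
  simp only [permutedSum]
  rw [sum_comm, sum_div]
  refine sum_congr rfl fun i _ => ?_
  rw [div_eq_div_iff (by positivity) hn', mul_comm, card_mul_sum_perm_apply (a i) i, mul_comm]

open Finset in
/-- A permuted sum has moment generating function bounded by a geometric mean of those
of independent uniform choices from the rows. -/
lemma IsUniformPermutation.sq_integral_exp_permutedSum_le {Ω : Type*} [MeasurableSpace Ω]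
    {P : Measure Ω} {n : ℕ} (hn : 0 < n) {π : Ω → Equiv.Perm (Fin n)}
    (hπ : IsUniformPermutation P π) (b : Fin n → Fin n → ℝ) :
    (∫ ω, Real.exp (permutedSum b (π ω)) ∂P) ^ 2 ≤
      ∏ i, (∑ j, Real.exp (2 * b i j)) / n := by
  have hn' : (0 : ℝ) < n := by positivity
  have h := sq_sum_perm_prod_le (fun i j => Real.exp (b i j)) fun _ _ => Real.exp_pos _
  have e : ∑ σ : Equiv.Perm (Fin n), ∏ i, Real.exp (b (σ i) i) =
      ∑ σ : Equiv.Perm (Fin n), Real.exp (permutedSum b σ) := by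
    -- Inverting `σ` passes from the column form of the permanent to the row form.
    rw [← Equiv.sum_comp (Equiv.inv (Equiv.Perm (Fin n)))]
    refine sum_congr rfl fun σ _ => ?_
    rw [permutedSum, Real.exp_sum, ← Equiv.prod_comp σ]
    simp
  simp only [e, ← Real.exp_nat_mul] at h
  rw [hπ.integral_comp fun σ => Real.exp (permutedSum b σ), div_pow, prod_div_distrib,
    prod_const, card_univ, Fintype.card_fin, div_le_div_iff₀ (by positivity) (by positivity)]
  push_cast at h
  linarith

open Finset in
lemma sum_exp_div_card_le {ι : Type*} [Fintype ι] [Nonempty ι] (u : ι → ℝ) (hu : ∀ j, |u j| ≤ 1) :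
    (∑ j, Real.exp (u j)) / Fintype.card ι ≤
      Real.exp ((∑ j, u j) / Fintype.card ι + (∑ j, u j ^ 2) / Fintype.card ι) := by
  have hc : (0 : ℝ) < Fintype.card ι := by exact_mod_cast Fintype.card_pos
  refine le_trans ?_ (Real.add_one_le_exp _)
  rw [div_le_iff₀ hc, add_mul, add_mul, div_mul_cancel₀ _ hc.ne', div_mul_cancel₀ _ hc.ne']
  calc ∑ j, Real.exp (u j) ≤ ∑ j, (u j + u j ^ 2 + 1) := sum_le_sum fun j _ => by
        linarith [le_of_abs_le (Real.abs_exp_sub_one_sub_id_le (hu j))]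
    _ = _ := by simp [sum_add_distrib]

open Finset in
/-- Sub-gamma bound for the moment generating function of a centred permuted sum. -/
lemma IsUniformPermutation.integral_exp_mul_sub_le {Ω : Type*} [MeasurableSpace Ω]
    {P : Measure Ω} {n : ℕ} (hn : 0 < n) {π : Ω → Equiv.Perm (Fin n)}
    (hπ : IsUniformPermutation P π) (a : Fin n → Fin n → ℝ) (l : ℝ)
    (hl : ∀ i j, |2 * (l * a i j)| ≤ 1) :
    ∫ ω, Real.exp (l * (permutedSum a (π ω) - ∫ ω', permutedSum a (π ω') ∂P)) ∂P ≤
      Real.exp (2 * l ^ 2 * (1 / (n : ℝ) * ∑ i, ∑ j, a i j ^ 2)) := by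
  have : Nonempty (Fin n) := ⟨⟨0, hn⟩⟩
  rw [hπ.integral_permutedSum hn]
  set m := ∑ i, (∑ j, a i j) / (n : ℝ) with hm
  set v := 1 / (n : ℝ) * ∑ i, ∑ j, a i j ^ 2 with hv
  have h := hπ.sq_integral_exp_permutedSum_le hn fun i j => l * a i j
  have hrow : ∏ i, (∑ j, Real.exp (2 * (l * a i j))) / (n : ℝ) ≤
      Real.exp (2 * l * m + 4 * l ^ 2 * v) := by
    have e : 2 * l * m + 4 * l ^ 2 * v = ∑ i, ((∑ j, 2 * (l * a i j)) / (n : ℝ) +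
        (∑ j, (2 * (l * a i j)) ^ 2) / (n : ℝ)) := by
      simp only [hm, hv, mul_pow, ← mul_sum, sum_add_distrib, ← sum_div]
      ring
    rw [e, Real.exp_sum]
    refine prod_le_prod (fun i _ => by positivity) fun i _ => ?_
    simpa using sum_exp_div_card_le (fun j => 2 * (l * a i j)) (hl i)
  have hps : ∀ σ, permutedSum (fun i j => l * a i j) σ = l * permutedSum a σ := fun σ => by
    simp [permutedSum, mul_sum]
  simp only [hps] at h
  have h2 : ∫ ω, Real.exp (l * permutedSum a (π ω)) ∂P ≤ Real.exp (l * m + 2 * l ^ 2 * v) := by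
    refine le_of_sq_le_sq ((h.trans hrow).trans_eq ?_) (Real.exp_pos _).le
    rw [← Real.exp_nat_mul]
    congr 1
    push_cast
    ring
  have e2 : ∀ ω, Real.exp (l * (permutedSum a (π ω) - m)) =
      Real.exp (l * permutedSum a (π ω)) * Real.exp (-(l * m)) := fun ω => by
    rw [← Real.exp_add]; ring_nf
  simp only [e2]
  rw [integral_mul_const]
  refine (mul_le_mul_of_nonneg_right h2 (Real.exp_pos _).le).trans_eq ?_
  rw [← Real.exp_add]; ring_nf

/-! ### Chernoff bound -/

/-- The parameter choice in the Chernoff bound. -/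
lemma exists_chernoff_parameter {v M x : ℝ} (hv : 0 < v) (hM : 0 < M) (hx : 0 < x) :
    ∃ l, 0 < l ∧ 2 * l * M ≤ 1 ∧
      x / 2 ≤ l * (2 * √(v * x) + M * x) - 2 * l ^ 2 * v := by
  set p := √v with hp
  set q := √x with hq
  have hp0 : 0 < p := Real.sqrt_pos.2 hv
  have hq0 : 0 < q := Real.sqrt_pos.2 hx
  have hvp : v = p ^ 2 := (Real.sq_sqrt hv.le).symm
  have hxq : x = q ^ 2 := (Real.sq_sqrt hx.le).symm
  rw [Real.sqrt_mul hv.le, ← hp, ← hq, hvp, hxq]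
  -- The maximiser of `2 * l * p * q - 2 * l ^ 2 * p ^ 2` is `q / (2 * p)`, admissible exactly when
  -- `M * q ≤ p`; otherwise the largest admissible `l` is taken, and the term `M * x` supplies `x /
  -- 2`.
  rcases le_total (M * q) p with h | h
  · refine ⟨q / (2 * p), by positivity, ?_, ?_⟩
    · rw [show 2 * (q / (2 * p)) * M = M * q / p by field_simp, div_le_one hp0]
      exact h
    · have : q / (2 * p) * (2 * (p * q) + M * q ^ 2) - 2 * (q / (2 * p)) ^ 2 * p ^ 2 =
          q ^ 2 / 2 + q ^ 3 * M / (2 * p) := by field_simp; ring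
      rw [this]
      have : 0 ≤ q ^ 3 * M / (2 * p) := by positivity
      linarith
  · refine ⟨1 / (2 * M), by positivity, by field_simp; rfl, ?_⟩
    have : 1 / (2 * M) * (2 * (p * q) + M * q ^ 2) - 2 * (1 / (2 * M)) ^ 2 * p ^ 2 =
        q ^ 2 / 2 + p * (2 * M * q - p) / (2 * M ^ 2) := by field_simp; ring
    rw [this]
    have : 0 ≤ p * (2 * M * q - p) / (2 * M ^ 2) :=
      div_nonneg (mul_nonneg hp0.le (by nlinarith)) (by positivity)
    linarith

open Finset in
theorem IsUniformPermutation.measureReal_le_abs_permutedSum_sub_le {Ω : Type*} [MeasurableSpace Ω]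
    {P : Measure Ω} [IsProbabilityMeasure P] {n : ℕ} {a : Fin n → Fin n → ℝ}
    (ha : ∀ i j, 0 ≤ a i j) (ha0 : ∃ i j, a i j ≠ 0) {π : Ω → Equiv.Perm (Fin n)}
    (hπ : IsUniformPermutation P π) {x : ℝ} (hx : 0 < x) :
    P.real {ω | 2 * √((1 / (n : ℝ) * ∑ i, ∑ j, a i j ^ 2) * x) + (⨆ i, ⨆ j, a i j) * x ≤
        |permutedSum a (π ω) - ∫ ω', permutedSum a (π ω') ∂P|} ≤
      2 * Real.exp (-x / 2) := by
  obtain ⟨i₀, j₀, h0⟩ := ha0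
  have hn : 0 < n := i₀.pos
  have haM : ∀ i j, a i j ≤ ⨆ i, ⨆ j, a i j := fun i j =>
    (le_ciSup (Set.finite_range (a i)).bddAbove j).trans
      (le_ciSup (Set.finite_range fun i => ⨆ j, a i j).bddAbove i)
  have hpos : 0 < a i₀ j₀ := lt_of_le_of_ne (ha _ _) h0.symm
  set M := ⨆ i, ⨆ j, a i j with hM
  have hM0 : 0 < M := hpos.trans_le (haM _ _)
  have hv0 : 0 < 1 / (n : ℝ) * ∑ i, ∑ j, a i j ^ 2 := by
    have h1 : a i₀ j₀ ^ 2 ≤ ∑ j, a i₀ j ^ 2 :=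
      single_le_sum (f := fun j => a i₀ j ^ 2) (fun j _ => sq_nonneg _) (mem_univ j₀)
    have h2 : ∑ j, a i₀ j ^ 2 ≤ ∑ i, ∑ j, a i j ^ 2 :=
      single_le_sum (f := fun i => ∑ j, a i j ^ 2)
        (fun i _ => sum_nonneg fun j _ => sq_nonneg _) (mem_univ i₀)
    have : 0 < a i₀ j₀ ^ 2 := by positivity
    exact mul_pos (by positivity) (by linarith)
  obtain ⟨l, hl0, hlM, hl⟩ := exists_chernoff_parameter hv0 hM0 hx
  set v := 1 / (n : ℝ) * ∑ i, ∑ j, a i j ^ 2 with hv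
  set t := 2 * √(v * x) + M * x with ht
  set m := ∫ ω', permutedSum a (π ω') ∂P with hm
  have hla : ∀ i j, |2 * (l * a i j)| ≤ 1 := fun i j => by
    rw [abs_of_nonneg (by have := ha i j; positivity)]
    nlinarith [mul_le_mul_of_nonneg_left (haM i j) hl0.le]
  have hla' : ∀ i j, |2 * (-l * a i j)| ≤ 1 := fun i j => by
    rw [show 2 * (-l * a i j) = -(2 * (l * a i j)) by ring, abs_neg]
    exact hla i j
  have hup : P.real {ω | t ≤ permutedSum a (π ω) - m} ≤ Real.exp (-x / 2) := by
    refine (measure_ge_le_exp_mul_mgf t hl0.le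
      (hπ.integrable_comp fun σ => Real.exp (l * (permutedSum a σ - m)))).trans ?_
    refine (mul_le_mul_of_nonneg_left (hπ.integral_exp_mul_sub_le hn a l hla)
      (Real.exp_pos _).le).trans ?_
    rw [← Real.exp_add]
    exact Real.exp_le_exp.2 (by linarith)
  -- The moment bound is even in `l`, so `-l` serves the lower tail.
  have hlo : P.real {ω | permutedSum a (π ω) - m ≤ -t} ≤ Real.exp (-x / 2) := by
    refine (measure_le_le_exp_mul_mgf (-t) (neg_nonpos.2 hl0.le)
      (hπ.integrable_comp fun σ => Real.exp (-l * (permutedSum a σ - m)))).trans ?_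
    refine (mul_le_mul_of_nonneg_left (hπ.integral_exp_mul_sub_le hn a (-l) hla')
      (Real.exp_pos _).le).trans ?_
    rw [← Real.exp_add]
    exact Real.exp_le_exp.2 (by nlinarith)
  calc P.real {ω | t ≤ |permutedSum a (π ω) - m|}
      ≤ P.real ({ω | t ≤ permutedSum a (π ω) - m} ∪ {ω | permutedSum a (π ω) - m ≤ -t}) :=
        measureReal_mono fun ω (hω : t ≤ |permutedSum a (π ω) - m|) => (le_abs'.1 hω).symm
    _ ≤ _ := measureReal_union_le _ _
    _ ≤ 2 * Real.exp (-x / 2) := by linarith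

theorem proposition2p2 {Ω : Type*} [MeasurableSpace Ω] (P : Measure Ω) [IsProbabilityMeasure P]
    (n : ℕ) (a : Fin n → Fin n → ℝ) (ha : ∀ i j, 0 ≤ a i j) (ha0 : ∃ i j, a i j ≠ 0)
    (π : Ω → Equiv.Perm (Fin n)) (hπ : IsUniformPermutation P π) (x : ℝ) (hx : 0 < x) :
    P.real {ω | 2 * √((1 / (n : ℝ) * ∑ i, ∑ j, a i j ^ 2) * x) + (⨆ i, ⨆ j, a i j) * x ≤
        |permutedSum a (π ω) - ∫ ω', permutedSum a (π ω') ∂P|} ≤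
      8 * Real.exp (1 / 16) * Real.exp (-x / 16) := by
  refine (hπ.measureReal_le_abs_permutedSum_sub_le ha ha0 hx).trans ?_
  have h1 : (1 : ℝ) ≤ Real.exp (1 / 16) := Real.one_le_exp (by norm_num)
  have h2 : Real.exp (-x / 2) ≤ Real.exp (-x / 16) := Real.exp_le_exp.2 (by linarith)
  gcongr
  linarith
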